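/- Let $\mathrm{CGA}$ be the real Clifford algebra of signature $(4,1)$ with orthonormal generators $e_1,e_2,e_3,e_+,e_-$ ($e_1^2=e_2^2=e_3^2=e_+^2=1$, $e_-^2=-1$), $e_{ij}=e_ie_j$, reversion $a\mapsto\tilde a$ and even subalgebra $\mathrm{CGA}_+$. Let $\mathbb{DH}\subset\mathrm{CGA}_+$ be the dual quaternions, the real span of $1,\ e_{23},\ e_{13},\ e_{12},\ e_1e_2e_3(e_++e_-),\ e_1(e_++e_-),\ e_2(e_++e_-),\ e_3(e_++e_-)$. Polynomials over $\mathrm{CGA}$ have an indeterminate $t$ that commutes with all coefficients, and $\tilde C$ is obtained by reverting the coefficients of $C$. A motion polynomial is a polynomial $C\in\mathrm{CGA}_+[t]$ with $C\tilde C=\tilde CC\in\mathbb{R}[t]\setminus\{0\}$; it is Euclidean if $C\in\mathbb{DH}[t]$. A factorization of $C$ is a representation $C=(t-h_1)\cdots(t-h_n)$ in which every $t-h_i$ is a motion polynomial over $\mathrm{CGA}_+$. It is irregular if for some $\ell\in\{1,\dots,n\}$ the remainder $r_1t+r_0$ of $(t-h_1)\cdots(t-h_\ell)$ or of $(t-h_\ell)\cdots(t-h_n)$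 upon division by $(t-h_\ell)(t-\tilde h_\ell)$ has a non-invertible coefficient $r_1$. $C$ is trivial if there are $f\colon\mathbb{R}\to\mathbb{R}$ and $h\in\mathrm{CGA}_+$ with $h\tilde h\in\mathbb{R}$ such that, for all but finitely many $t\in\mathbb{R}$, $C(t)$ is a non-zero real multiple of $f(t)-h$. Two polynomials $C,C'$ are Euclidean equivalent if there are $a\in\mathbb{DH}$ with $a\tilde a=\tilde aa\in\mathbb{R}\setminus\{0\}$ and $c,\alpha,\beta\in\mathbb{R}$ with $c,\alpha\neq0$ such that $c\,C'(t)=a\,C(\alpha t+\beta)\,\tilde a$ (a Euclidean change of coordinates together with an affine change of the motion parameter). **Theorem (Circular Translation).** For $(x,y)\in\mathbb{R}^2\setminus\{(0,0)\}$ let $$C_{x,y}:=\bigl(t-(-e_{12}+(xe_1+ye_2)(e_-+e_+))\bigr)(t-e_{12}).$$ A monic quadratic Euclidean motion polynomial $C$ is non-trivial and has an irregular factorization if and only if it is Euclidean equivalent to $C_{x,y}$ for some $(x,y)\neq(0,0)$. Moreover, every such $C_{x,y}$ is itself a non-trivial monic quadratic Euclidean motion polynomial, and its displayed factorization is irregular.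 -/

import Mathlib

noncomputable section

namespace MotionPoly

open Polynomial

/-- The quadratic form of signature `(4,1)` on `ℝ⁵`; the coordinates are `1, 2, 3, +, -`. -/
abbrev cgaForm : QuadraticForm ℝ (Fin 5 → ℝ) :=
  QuadraticMap.weightedSumSquares ℝ (![1, 1, 1, 1, -1] : Fin 5 → ℝ)

/-- Conformal geometric algebra: the Clifford algebra of `ℝ^{4,1}`. -/
abbrev CGA : Type := CliffordAlgebra cgaForm

/-- The orthonormal basis vectors, in the order `e₁, e₂, e₃, e₊, e₋`. -/
def e (i : Fin 5) : CGA := CliffordAlgebra.ι cgaForm (Pi.single i 1)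

abbrev e₁ : CGA := e 0
abbrev e₂ : CGA := e 1
abbrev e₃ : CGA := e 2
abbrev ePlus : CGA := e 3
abbrev eMinus : CGA := e 4

/-- Reversion of algebra elements. -/
abbrev rev (a : CGA) : CGA := CliffordAlgebra.reverse a

/-- The even sub-algebra `CGA₊`. -/
abbrev CGAeven : Subalgebra ℝ CGA := CliffordAlgebra.even cgaForm

/-- The dual quaternions, as a linear subspace of `CGA₊`. -/
def DH : Submodule ℝ CGA :=
  Submodule.span ℝ {1, e₂ * e₃, e₁ * e₃, e₁ * e₂,
    e₁ * e₂ * e₃ * ePlus + e₁ * e₂ * e₃ * eMinus,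
    e₁ * ePlus + e₁ * eMinus, e₂ * ePlus + e₂ * eMinus, e₃ * ePlus + e₃ * eMinus}

/-- Reversion of polynomials: reversion of all coefficients (the indeterminate is real). -/
def revPoly (P : CGA[X]) : CGA[X] := P.sum fun i a => monomial i (rev a)

theorem coeff_revPoly (P : CGA[X]) (i : ℕ) : (revPoly P).coeff i = rev (P.coeff i) := by
  unfold revPoly Polynomial.sum
  rw [finsetSum_coeff]
  simp only [coeff_monomial]
  rw [Finset.sum_ite_eq']
  split_ifs with h
  · rfl
  · rw [notMem_support_iff.mp h]
    simp

/-- A motion polynomial: coefficients in `CGA₊`, and `P P̃ = P̃ P ∈ ℝ[t] \ {0}`. -/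
def IsMotionPolynomial (P : CGA[X]) : Prop :=
  (∀ i, P.coeff i ∈ CGAeven) ∧
    ∃ N : ℝ[X], N ≠ 0 ∧ P * revPoly P = N.map (algebraMap ℝ CGA) ∧
      revPoly P * P = N.map (algebraMap ℝ CGA)

/-- A Euclidean motion polynomial: a motion polynomial over the dual quaternions. -/
def IsEuclideanMotionPolynomial (P : CGA[X]) : Prop :=
  IsMotionPolynomial P ∧ ∀ i, P.coeff i ∈ DH

/-- The product `(t - h₁)(t - h₂) ⋯ (t - hₙ)`. -/
def linProd (hs : List CGA) : CGA[X] := (hs.map fun h => X - C h).prod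

/-- A factorization of `P` into simple motions, `P = (t - h₁) ⋯ (t - hₙ)`: every linear factor
`t - hᵢ` is itself a motion polynomial over `CGA₊`. -/
def IsFactorization (P : CGA[X]) (hs : List CGA) : Prop :=
  (∀ h ∈ hs, IsMotionPolynomial (X - C h)) ∧ P = linProd hs

/-- The quadrance polynomial `M = (t - h)(t - h̃)` of `t - h`. -/
def quadrance (h : CGA) : CGA[X] := (X - C h) * (X - C (rev h))

theorem monic_quadrance (h : CGA) : (quadrance h).Monic :=
  (monic_X_sub_C h).mul (monic_X_sub_C (rev h))

/-- A factorization `P = (t - h₁) ⋯ (t - hₙ)` is irregular if for some `ℓ` the linear remainder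
`r₁ t + r₀` of `(t - h₁) ⋯ (t - h_ℓ)` or of `(t - h_ℓ) ⋯ (t - hₙ)` upon division by
`(t - h_ℓ)(t - h̃_ℓ)` has a non-invertible coefficient `r₁`. (List positions start at `0`.) -/
def IsIrregularFactorization (P : CGA[X]) (hs : List CGA) : Prop :=
  IsFactorization P hs ∧ ∃ l : Fin hs.length,
    (¬ IsUnit ((linProd (hs.take (l + 1)) %ₘ quadrance (hs.get l)).coeff 1) ∨
      ¬ IsUnit ((linProd (hs.drop l) %ₘ quadrance (hs.get l)).coeff 1))

/-- `P` is irregularly factorizable: it has an irregular factorization over `CGA₊`. -/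
def IrregularlyFactorizable (P : CGA[X]) : Prop := ∃ hs, IsIrregularFactorization P hs

/-- `P` is trivial: for some `h ∈ CGA₊` with `h h̃ ∈ ℝ` and some `f : ℝ → ℝ`, the points `[P(t)]`
and `[f(t) - h]` of projective space coincide, for all but finitely many real `t`. -/
def IsTrivialMotion (P : CGA[X]) : Prop :=
  ∃ (f : ℝ → ℝ) (h : CGA), h ∈ CGAeven ∧ (∃ r : ℝ, h * rev h = algebraMap ℝ CGA r) ∧
    {t : ℝ | ¬ ∃ c : ℝ, c ≠ 0 ∧
      P.eval (algebraMap ℝ CGA t) = c • (algebraMap ℝ CGA (f t) - h)}.Finite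

/-- Euclidean displacements (not normalized): `a ∈ DH` with `a ã = ã a ∈ ℝ \ {0}`. -/
def IsEuclideanDisplacement (a : CGA) : Prop :=
  a ∈ DH ∧ ∃ r : ℝ, r ≠ 0 ∧ a * rev a = algebraMap ℝ CGA r ∧ rev a * a = algebraMap ℝ CGA r

/-- Euclidean equivalence of the motions given by `P` and `P'`: `[P'(t)] = [a P(α t + β) ã]` for a
Euclidean displacement `a` and a real affine change `t ↦ α t + β` of the motion parameter. -/
def EuclideanEquivalent (P P' : CGA[X]) : Prop :=
  ∃ a : CGA, IsEuclideanDisplacement a ∧ ∃ c α β : ℝ, c ≠ 0 ∧ α ≠ 0 ∧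
    c • P' = C a * P.comp (C (algebraMap ℝ CGA α) * X + C (algebraMap ℝ CGA β)) * C (rev a)

/-- The left rotation `-e₁₂ + (x e₁ + y e₂)(e₋ + e₊)` of the circular translation. -/
def circLeft (x y : ℝ) : CGA := -(e₁ * e₂) + (x • e₁ + y • e₂) * (eMinus + ePlus)

/-- The circular translation `(t - (-e₁₂ + (x e₁ + y e₂)(e₋ + e₊)))(t - e₁₂)`. -/
def circTrans (x y : ℝ) : CGA[X] := (X - C (circLeft x y)) * (X - C (e₁ * e₂))

end MotionPoly

end

noncomputable section

namespace MotionPoly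

open Polynomial Quaternion

/-! ### Dual quaternions inside the conformal geometric algebra -/

/-! Write ε for `dualUnit`. It is non-zero, squares to zero and commutes with the quaternions H
spanned by 1, e₂₃, e₁₃, e₁₂, so the dual quaternions are H + εH. The element p + εq is invertible
exactly when p ≠ 0, even inside the larger algebra.

Let P = (t - h₁)(t - h₂) with hᵢ + h̃ᵢ = sᵢ. The factors need not be dual quaternions, but their sum
and product are. The only remainder coefficients that matter are sᵢ - (h₁ + h₂), so irregularity
makes the primal part of h₁ + h₂ equal to s₁ or s₂. Comparing real parts then gives s₁ = s₂ = 2s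
(`exists_shift_of_irregular`). The shifted kᵢ = hᵢ - s satisfy k̃ᵢ = -kᵢ, kᵢ² = -n and k₁ + k₂ =
-εq.

Since k₁k₂ is a dual quaternion too, k₁εq lies in εH (`dual_part_of_product`). If q ≠ 0, left
multiplication by k₁ acts on εH as that by a quaternion g with g² = -n
(`exists_root_of_dual_relation`). If q = 0 or g is real, P is trivial. Otherwise g is pure, n = |g|²
> 0, and q and gq are pure; hence q is orthogonal to g. Rotating g onto the e₁₂ axis and rescaling t
by √n gives the circular translation (`exists_equivalent_circTrans`).

Conversely, conjugation carries the irregular factorization of `circTrans` to any equivalent P. A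
trivial motion has a real combination of two of its values, up to real summands; the independent
dual parts of `circTrans` exclude this. -/

theorem e_mul_self (i : Fin 5) :
    e i * e i = algebraMap ℝ CGA ((![1, 1, 1, 1, -1] : Fin 5 → ℝ) i) := by
  unfold e
  rw [CliffordAlgebra.ι_sq_scalar]
  simp [QuadraticMap.weightedSumSquares_apply, Pi.single_apply]

theorem e_anticomm {i j : Fin 5} (h : j < i) : e i * e j = -(e j * e i) := by
  have hne : i ≠ j := ne_of_gt h
  rw [eq_neg_iff_add_eq_zero]
  unfold e
  refine CliffordAlgebra.ι_mul_ι_add_swap_of_isOrtho ?_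
  rw [QuadraticMap.isOrtho_def]
  simp only [QuadraticMap.weightedSumSquares_apply, Pi.add_apply, Pi.single_apply,
    ← Finset.sum_add_distrib]
  refine Finset.sum_congr rfl fun k _ => ?_
  by_cases hi : k = i
  · subst hi; simp [hne]
  · simp [hi]

theorem e_anticomm_assoc {i j : Fin 5} (h : j < i) (x : CGA) :
    e i * (e j * x) = -(e j * (e i * x)) := by
  rw [← mul_assoc, e_anticomm h, neg_mul, mul_assoc]

theorem e_sq_one {i : Fin 5} (h : i < 4) : e i * e i = 1 := by
  rw [e_mul_self]
  fin_cases i <;> simp_all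

theorem e_sq_one_assoc {i : Fin 5} (h : i < 4) (x : CGA) : e i * (e i * x) = x := by
  rw [← mul_assoc, e_sq_one h, one_mul]

theorem e_four_sq : e 4 * e 4 = -1 := by
  rw [e_mul_self]; simp

theorem rev_mul (a b : CGA) : rev (a * b) = rev b * rev a := CliffordAlgebra.reverse.map_mul a b

theorem rev_add (a b : CGA) : rev (a + b) = rev a + rev b := map_add _ a b

theorem rev_sub (a b : CGA) : rev (a - b) = rev a - rev b := map_sub _ a b

theorem rev_smul (r : ℝ) (a : CGA) : rev (r • a) = r • rev a := map_smul _ r a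

theorem rev_algebraMap (r : ℝ) : rev (algebraMap ℝ CGA r) = algebraMap ℝ CGA r :=
  CliffordAlgebra.reverse.commutes r

theorem rev_e (i : Fin 5) : rev (e i) = e i := CliffordAlgebra.reverse_ι _

/-- The quaternion with the given coordinates. -/
def mkQuat (a b c d : ℝ) : ℍ[ℝ] := ⟨a, b, c, d⟩

@[simp] theorem mkQuat_re (a b c d : ℝ) : (mkQuat a b c d).re = a := rfl

@[simp] theorem mkQuat_imI (a b c d : ℝ) : (mkQuat a b c d).imI = b := rfl

@[simp] theorem mkQuat_imJ (a b c d : ℝ) : (mkQuat a b c d).imJ = c := rfl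

@[simp] theorem mkQuat_imK (a b c d : ℝ) : (mkQuat a b c d).imK = d := rfl

/-- The quaternion units `e₂₃`, `e₁₃`, `e₁₂`. -/
def quatBasis : QuaternionAlgebra.Basis CGA (-1 : ℝ) 0 (-1) where
  i := e₂ * e₃
  j := e₁ * e₃
  k := e₁ * e₂
  i_mul_i := by
    simp (disch := decide) [mul_assoc, e_anticomm_assoc, e_sq_one]
  j_mul_j := by
    simp (disch := decide) [mul_assoc, e_anticomm_assoc, e_sq_one]
  i_mul_j := by
    simp (disch := decide) [mul_assoc, e_anticomm, e_anticomm_assoc, e_sq_one]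
  j_mul_i := by
    simp (disch := decide) [mul_assoc, e_anticomm_assoc, e_sq_one]

/-- The embedding of the quaternions. -/
def quat : ℍ[ℝ] →ₐ[ℝ] CGA := quatBasis.liftHom

theorem quat_apply (p : ℍ[ℝ]) : quat p = algebraMap ℝ CGA p.re + p.imI • (e₂ * e₃) +
    p.imJ • (e₁ * e₃) + p.imK • (e₁ * e₂) := rfl

/-- The dual unit. -/
def dualUnit : CGA := e₁ * e₂ * e₃ * ePlus + e₁ * e₂ * e₃ * eMinus

theorem dualUnit_sq : dualUnit * dualUnit = 0 := by
  simp (disch := decide) [dualUnit, mul_add, add_mul, mul_assoc, e_anticomm, e_anticomm_assoc,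
    e_sq_one, e_sq_one_assoc, e_four_sq]

theorem dualUnit_comm (p : ℍ[ℝ]) : quat p * dualUnit = dualUnit * quat p := by
  rw [quat_apply]
  simp (disch := decide) only [e₁, e₂, e₃, ePlus, eMinus, dualUnit, mul_add, add_mul,
      mul_assoc, e_anticomm, e_anticomm_assoc,
    e_sq_one_assoc, Algebra.algebraMap_eq_smul_one, mul_smul_comm, smul_mul_assoc, mul_one, one_mul,
    mul_neg, neg_neg, smul_neg, smul_add]
  abel

/-- Since (e₁e₂e₃)² = -1, the product e₁e₂e₃ε is the vector -(e₊ + e₋), whose anticommutator with e₊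
is -2. -/
theorem dualUnit_ne_zero : dualUnit ≠ 0 := by
  intro h
  have h1 : e₁ * e₂ * e₃ * dualUnit * ePlus + ePlus * (e₁ * e₂ * e₃ * dualUnit) = -2 := by
    simp (disch := decide) only [e₁, e₂, e₃, ePlus, eMinus, dualUnit, mul_add, add_mul,
      mul_assoc, e_anticomm, e_anticomm_assoc,
      e_sq_one, e_sq_one_assoc, neg_mul, mul_neg, neg_neg]
    rw [← one_add_one_eq_two]
    abel
  rw [h] at h1
  have h2 : (algebraMap ℝ CGA) (-2) = algebraMap ℝ CGA 0 := by
    rw [map_neg, map_ofNat, map_zero, ← h1]; simp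
  have := (algebraMap ℝ CGA).injective h2
  norm_num at this

theorem rev_quat (p : ℍ[ℝ]) : rev (quat p) = quat (star p) := by
  rw [quat_apply, quat_apply]
  simp (disch := decide) only [rev_add, rev_smul, rev_mul, rev_e, rev_algebraMap, e_anticomm]
  simp

theorem rev_dualUnit : rev dualUnit = dualUnit := by
  simp (disch := decide) only [dualUnit, e₁, e₂, e₃, ePlus, eMinus, rev_add, rev_mul, rev_e,
    mul_assoc, e_anticomm, e_anticomm_assoc, neg_mul, mul_neg, neg_neg]

/-- The dual quaternion with primal part `p` and dual part `q`. -/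
def dq (p q : ℍ[ℝ]) : CGA := quat p + dualUnit * quat q

theorem dq_mul (p q p' q' : ℍ[ℝ]) : dq p q * dq p' q' = dq (p * p') (p * q' + q * p') := by
  unfold dq
  have h1 : quat p * (dualUnit * quat q') = dualUnit * (quat p * quat q') := by
    rw [← mul_assoc, dualUnit_comm, mul_assoc]
  have h2 : dualUnit * quat q * (dualUnit * quat q') = 0 := by
    rw [mul_assoc, ← mul_assoc (quat q), dualUnit_comm, ← mul_assoc, ← mul_assoc, dualUnit_sq,
      zero_mul, zero_mul]
  simp only [map_mul, map_add, mul_add, add_mul, h1, h2]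
  rw [mul_assoc]; abel

theorem dq_add (p q p' q' : ℍ[ℝ]) : dq p q + dq p' q' = dq (p + p') (q + q') := by
  simp only [dq, map_add, mul_add]; abel

theorem dq_neg (p q : ℍ[ℝ]) : -dq p q = dq (-p) (-q) := by
  simp only [dq, map_neg, mul_neg, neg_add]

theorem dq_sub (p q p' q' : ℍ[ℝ]) : dq p q - dq p' q' = dq (p - p') (q - q') := by
  rw [sub_eq_add_neg, dq_neg, dq_add, ← sub_eq_add_neg, ← sub_eq_add_neg]

theorem dq_smul (r : ℝ) (p q : ℍ[ℝ]) : r • dq p q = dq (r • p) (r • q) := by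
  simp only [dq, map_smul, mul_smul_comm, smul_add]

theorem algebraMap_eq_dq (r : ℝ) : algebraMap ℝ CGA r = dq (r : ℍ[ℝ]) 0 := by
  have : quat (r : ℍ[ℝ]) = algebraMap ℝ CGA r := quat.commutes r
  simp [dq, this]

theorem rev_dq (p q : ℍ[ℝ]) : rev (dq p q) = dq (star p) (star q) := by
  unfold dq
  rw [rev_add, rev_mul, rev_quat, rev_quat, rev_dualUnit, dualUnit_comm]

theorem eq_zero_of_dualUnit_mul_quat {q : ℍ[ℝ]} (h : dualUnit * quat q = 0) : q = 0 := by
  by_contra hq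
  apply dualUnit_ne_zero
  rw [← mul_one dualUnit, ← map_one quat, ← mul_inv_cancel₀ hq, map_mul, ← mul_assoc, h, zero_mul]

/-- Multiplication by ε kills the dual part and isolates p. -/
theorem dq_eq_zero {p q : ℍ[ℝ]} (h : dq p q = 0) : p = 0 ∧ q = 0 := by
  have hp : p = 0 := by
    apply eq_zero_of_dualUnit_mul_quat
    have h1 : dq 0 1 * dq p q = 0 := by rw [h, mul_zero]
    rw [dq_mul] at h1
    simpa [dq] using h1
  subst hp
  exact ⟨rfl, eq_zero_of_dualUnit_mul_quat (by simpa [dq] using h)⟩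

theorem dq_inj {p q p' q' : ℍ[ℝ]} : dq p q = dq p' q' ↔ p = p' ∧ q = q' := by
  refine ⟨fun h => ?_, fun h => by rw [h.1, h.2]⟩
  have := dq_eq_zero (p := p - p') (q := q - q') (by rw [← dq_sub, h, sub_self])
  exact ⟨sub_eq_zero.mp this.1, sub_eq_zero.mp this.2⟩

theorem isUnit_dq {p : ℍ[ℝ]} (q : ℍ[ℝ]) (hp : p ≠ 0) : IsUnit (dq p q) := by
  have h1 : dq 1 0 = 1 := by simp [dq]
  refine ⟨⟨dq p q, dq p⁻¹ (-(p⁻¹ * q * p⁻¹)), ?_, ?_⟩, rfl⟩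
  · rw [dq_mul, ← h1, dq_inj]
    refine ⟨mul_inv_cancel₀ hp, ?_⟩
    rw [mul_neg, ← mul_assoc, ← mul_assoc, mul_inv_cancel₀ hp, one_mul, neg_add_cancel]
  · rw [dq_mul, ← h1, dq_inj]
    refine ⟨inv_mul_cancel₀ hp, ?_⟩
    rw [neg_mul, mul_assoc, inv_mul_cancel₀ hp, mul_one, add_neg_cancel]

theorem not_isUnit_dq_zero (q : ℍ[ℝ]) : ¬ IsUnit (dq 0 q) := by
  intro h
  have h0 : dq 0 q * dq 0 q = 0 := by rw [dq_mul]; simp [dq]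
  exact not_isUnit_zero (h0 ▸ h.mul h)

theorem e_mul_e_mem_even (i j : Fin 5) : e i * e j ∈ CGAeven :=
  CliffordAlgebra.ι_mul_ι_mem_evenOdd_zero _ _ _

theorem quat_mem_even (p : ℍ[ℝ]) : quat p ∈ CGAeven := by
  rw [quat_apply]
  exact add_mem (add_mem (add_mem (algebraMap_mem _ _)
    (Subalgebra.smul_mem _ (e_mul_e_mem_even _ _) _))
    (Subalgebra.smul_mem _ (e_mul_e_mem_even _ _) _))
    (Subalgebra.smul_mem _ (e_mul_e_mem_even _ _) _)

theorem dualUnit_mem_even : dualUnit ∈ CGAeven := by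
  unfold dualUnit
  rw [mul_assoc (e₁ * e₂), mul_assoc (e₁ * e₂)]
  exact add_mem (mul_mem (e_mul_e_mem_even _ _) (e_mul_e_mem_even _ _))
    (mul_mem (e_mul_e_mem_even _ _) (e_mul_e_mem_even _ _))

theorem dq_mem_even (p q : ℍ[ℝ]) : dq p q ∈ CGAeven :=
  add_mem (quat_mem_even p) (mul_mem dualUnit_mem_even (quat_mem_even q))

/-- The signs come from e₁₂₃e₂₃ = -e₁, e₁₂₃e₁₃ = e₂ and e₁₂₃e₁₂ = -e₃. -/
theorem dq_apply (p q : ℍ[ℝ]) : dq p q = p.re • (1 : CGA) + p.imI • (e₂ * e₃) +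
    p.imJ • (e₁ * e₃) + p.imK • (e₁ * e₂) +
    q.re • (e₁ * e₂ * e₃ * ePlus + e₁ * e₂ * e₃ * eMinus) - q.imI • (e₁ * ePlus + e₁ * eMinus) +
    q.imJ • (e₂ * ePlus + e₂ * eMinus) - q.imK • (e₃ * ePlus + e₃ * eMinus) := by
  unfold dq
  rw [quat_apply, quat_apply, Algebra.algebraMap_eq_smul_one, Algebra.algebraMap_eq_smul_one]
  simp (disch := decide) only [dualUnit, mul_add, add_mul, mul_assoc, e_anticomm, e_anticomm_assoc,
    e_sq_one_assoc, mul_smul_comm, mul_one, mul_neg, neg_neg, smul_neg, smul_add]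
  abel

theorem mem_DH_iff {a : CGA} : a ∈ DH ↔ ∃ p q, a = dq p q := by
  constructor
  · intro h
    unfold DH at h
    induction h using Submodule.span_induction with
    | mem x hx =>
      simp only [Set.mem_insert_iff, Set.mem_singleton_iff] at hx
      rcases hx with rfl | rfl | rfl | rfl | rfl | rfl | rfl | rfl
      · exact ⟨(mkQuat 1 0 0 0), 0, by rw [dq_apply]; simp⟩
      · exact ⟨(mkQuat 0 1 0 0), 0, by rw [dq_apply]; simp⟩
      · exact ⟨(mkQuat 0 0 1 0), 0, by rw [dq_apply]; simp⟩
      · exact ⟨(mkQuat 0 0 0 1), 0, by rw [dq_apply]; simp⟩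
      · exact ⟨0, (mkQuat 1 0 0 0), by rw [dq_apply]; simp⟩
      · exact ⟨0, (mkQuat 0 (-1) 0 0), by rw [dq_apply]; simp [add_comm]⟩
      · exact ⟨0, (mkQuat 0 0 1 0), by rw [dq_apply]; simp⟩
      · exact ⟨0, (mkQuat 0 0 0 (-1)), by rw [dq_apply]; simp [add_comm]⟩
    | zero => exact ⟨0, 0, by simp [dq]⟩
    | add x y _ _ hx hy =>
      obtain ⟨p, q, rfl⟩ := hx
      obtain ⟨p', q', rfl⟩ := hy
      exact ⟨_, _, dq_add _ _ _ _⟩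
    | smul r x _ hx =>
      obtain ⟨p, q, rfl⟩ := hx
      exact ⟨_, _, dq_smul _ _ _⟩
  · rintro ⟨p, q, rfl⟩
    rw [dq_apply]
    have hs : ∀ x ∈ ({1, e₂ * e₃, e₁ * e₃, e₁ * e₂,
        e₁ * e₂ * e₃ * ePlus + e₁ * e₂ * e₃ * eMinus,
        e₁ * ePlus + e₁ * eMinus, e₂ * ePlus + e₂ * eMinus,
        e₃ * ePlus + e₃ * eMinus} : Set CGA), ∀ r : ℝ, r • x ∈ DH :=
      fun x hx r => Submodule.smul_mem _ r (Submodule.subset_span hx)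
    refine sub_mem (add_mem (sub_mem (add_mem (add_mem (add_mem (add_mem ?_ ?_) ?_) ?_) ?_) ?_) ?_)
      ?_ <;> exact hs _ (by simp) _

theorem e₁₂_eq_dq : e₁ * e₂ = dq (mkQuat 0 0 0 1) 0 := by
  rw [dq_apply]; simp

theorem circLeft_eq_dq (x y : ℝ) : circLeft x y = dq (mkQuat 0 0 0 (-1)) (mkQuat 0 (-x) y 0) := by
  rw [dq_apply]
  simp only [circLeft, mul_add, add_mul, smul_mul_assoc, mkQuat_re, mkQuat_imI, mkQuat_imJ,
    mkQuat_imK, zero_smul, neg_smul, smul_add, one_smul]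
  abel

/-! ### Linear and quadratic polynomials over the conformal geometric algebra -/

theorem eq_quadratic_of_monic {P : CGA[X]} (hm : P.Monic) (hd : P.natDegree = 2) :
    P = X ^ 2 + C (P.coeff 1) * X + C (P.coeff 0) := by
  conv_lhs => rw [P.as_sum_range, hd]
  have h2 : P.coeff 2 = 1 := by rw [← hd]; exact hm
  simp only [Finset.sum_range_succ, Finset.sum_range_zero, zero_add, h2]
  simp only [← C_mul_X_pow_eq_monomial]
  simp
  abel

theorem X_sub_C_mul_X_sub_C (h₁ h₂ : CGA) :
    (X - C h₁) * (X - C h₂) = X ^ 2 + C (-(h₁ + h₂)) * X + C (h₁ * h₂) := by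
  simp only [sub_mul, mul_sub, X_mul_C, map_neg, map_add, map_mul, neg_mul, add_mul, sq]
  abel

theorem quadratic_inj {A B A' B' : CGA} :
    (X ^ 2 + C A * X + C B : CGA[X]) = X ^ 2 + C A' * X + C B' ↔ A = A' ∧ B = B' := by
  refine ⟨fun h => ?_, fun h => by rw [h.1, h.2]⟩
  have h1 := congrArg (fun P => P.coeff 1) h
  have h0 := congrArg (fun P => P.coeff 0) h
  simp [coeff_X, coeff_C] at h1 h0
  exact ⟨h1, h0⟩

theorem revPoly_X_sub_C (h : CGA) : revPoly (X - C h) = X - C (rev h) := by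
  ext i
  rw [coeff_revPoly, coeff_sub, coeff_sub, coeff_X, coeff_C, coeff_C, rev_sub]
  split_ifs <;> simp

theorem revPoly_mul (P Q : CGA[X]) : revPoly (P * Q) = revPoly Q * revPoly P := by
  ext i
  rw [coeff_revPoly, coeff_mul, coeff_mul, ← Finset.Nat.sum_antidiagonal_swap]
  simp only [rev, map_sum, CliffordAlgebra.reverse.map_mul, coeff_revPoly, Prod.fst_swap,
    Prod.snd_swap]

theorem commute_map_algebraMap (N : ℝ[X]) (P : CGA[X]) :
    Commute (N.map (algebraMap ℝ CGA)) P := by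
  induction N using Polynomial.induction_on' with
  | add p q hp hq => rw [Polynomial.map_add]; exact hp.add_left hq
  | monomial n r =>
    rw [map_monomial, ← C_mul_X_pow_eq_monomial]
    refine Commute.mul_left ?_ ((commute_X_pow P n))
    exact Algebra.commutes (A := CGA[X]) r P

theorem IsMotionPolynomial.mul {P Q : CGA[X]} (hP : IsMotionPolynomial P)
    (hQ : IsMotionPolynomial Q) : IsMotionPolynomial (P * Q) := by
  obtain ⟨hP, N, hN, hN1, hN2⟩ := hP
  obtain ⟨hQ, M, hM, hM1, hM2⟩ := hQ
  refine ⟨fun i => ?_, N * M, mul_ne_zero hN hM, ?_, ?_⟩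
  · rw [coeff_mul]
    exact sum_mem fun x _ => mul_mem (hP _) (hQ _)
  · rw [revPoly_mul, Polynomial.map_mul, mul_assoc, ← mul_assoc Q, hM1, ← mul_assoc,
      ← (commute_map_algebraMap M P).eq, mul_assoc, hN1, (commute_map_algebraMap M _).eq]
  · rw [revPoly_mul, Polynomial.map_mul, mul_assoc, ← mul_assoc (revPoly P), hN2, ← mul_assoc,
      ← (commute_map_algebraMap N _).eq, mul_assoc, hM2]

/-- The trace condition makes h̃ = s - h commute with h, so one norm identity yields the other. -/
theorem isMotionPolynomial_X_sub_C {h : CGA} (he : h ∈ CGAeven) {s n : ℝ}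
    (hs : h + rev h = algebraMap ℝ CGA s) (hn : h * rev h = algebraMap ℝ CGA n) :
    IsMotionPolynomial (X - C h) := by
  have hr : rev h = algebraMap ℝ CGA s - h := by rw [← hs]; abel
  have hn' : rev h * h = algebraMap ℝ CGA n := by
    rw [← hn, hr, sub_mul, mul_sub, Algebra.commutes]
  refine ⟨fun i => ?_, X ^ 2 + C (-s) * X + C n, ?_, ?_, ?_⟩
  · rw [coeff_sub, coeff_X, coeff_C]
    refine sub_mem ?_ ?_
    · split_ifs
      exacts [one_mem _, zero_mem _]
    · split_ifs
      exacts [he, zero_mem _]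
  · exact (monic_X_pow_add (n := 2) (p := C (-s) * X + C n) (by compute_degree!)).ne_zero ∘
      fun h => by rw [← h]; ring
  · rw [revPoly_X_sub_C, X_sub_C_mul_X_sub_C, hs, hn]
    simp
  · rw [revPoly_X_sub_C, X_sub_C_mul_X_sub_C, add_comm (rev h), hs, hn']
    simp

theorem exists_trace_norm_of_isMotionPolynomial {h : CGA} (hm : IsMotionPolynomial (X - C h)) :
    h ∈ CGAeven ∧ ∃ s n : ℝ, h + rev h = algebraMap ℝ CGA s ∧ h * rev h = algebraMap ℝ CGA n := by
  obtain ⟨he, N, -, hN, -⟩ := hm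
  rw [revPoly_X_sub_C, X_sub_C_mul_X_sub_C] at hN
  refine ⟨?_, -N.coeff 1, N.coeff 0, ?_, ?_⟩
  · have := he 0
    rw [coeff_sub, coeff_X_zero, coeff_C_zero, zero_sub] at this
    exact neg_mem_iff.mp this
  · have := congrArg (fun P => P.coeff 1) hN
    simp [coeff_C] at this
    rw [map_neg, ← this]; abel
  · have := congrArg (fun P => P.coeff 0) hN
    simpa [coeff_X, coeff_C] using this

theorem linProd_pair (h₁ h₂ : CGA) : linProd [h₁, h₂] = (X - C h₁) * (X - C h₂) := by
  simp [linProd]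

theorem monic_linProd (hs : List CGA) : (linProd hs).Monic ∧ (linProd hs).natDegree = hs.length := by
  induction hs with
  | nil => simp [linProd]
  | cons h hs ih =>
    have : linProd (h :: hs) = (X - C h) * linProd hs := by simp [linProd]
    rw [this, (monic_X_sub_C h).natDegree_mul ih.1, ih.2, natDegree_X_sub_C, List.length_cons,
      add_comm]
    exact ⟨(monic_X_sub_C h).mul ih.1, rfl⟩

theorem degree_quadrance (h : CGA) : (quadrance h).degree = 2 := by
  rw [degree_eq_natDegree (monic_quadrance h).ne_zero, quadrance,
    (monic_X_sub_C h).natDegree_mul (monic_X_sub_C _), natDegree_X_sub_C, natDegree_X_sub_C]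
  rfl

theorem coeff_one_quadratic_modByMonic (A B h : CGA) :
    ((X ^ 2 + C A * X + C B) %ₘ quadrance h).coeff 1 = A + (h + rev h) := by
  have hlt : (C (A + (h + rev h)) * X + C (B - h * rev h)).degree < (quadrance h).degree := by
    rw [degree_quadrance]
    exact lt_of_le_of_lt degree_linear_le (by norm_num)
  rw [(div_modByMonic_unique 1 (C (A + (h + rev h)) * X + C (B - h * rev h)) (monic_quadrance h)
    ⟨?_, hlt⟩).2]
  · simp [coeff_C]
  · rw [mul_one, quadrance, X_sub_C_mul_X_sub_C]
    simp only [map_add, map_neg, map_sub, add_mul, neg_mul]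
    abel

theorem coeff_one_X_sub_C_modByMonic (h : CGA) : ((X - C h) %ₘ quadrance h).coeff 1 = 1 := by
  rw [modByMonic_eq_self_iff (monic_quadrance h) |>.mpr]
  · simp
  · rw [degree_quadrance, degree_X_sub_C]; norm_num

/-- A single linear factor is its own remainder, with leading coefficient 1. Only the full product,
reduced by either quadrance, can be irregular. -/
theorem isIrregularFactorization_pair_iff {P : CGA[X]} {h₁ h₂ : CGA} :
    IsIrregularFactorization P [h₁, h₂] ↔ IsFactorization P [h₁, h₂] ∧
      (¬ IsUnit (rev h₁ - h₂) ∨ ¬ IsUnit (rev h₂ - h₁)) := by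
  have e1 : ((X - C h₁) * (X - C h₂) %ₘ quadrance h₁).coeff 1 = rev h₁ - h₂ := by
    rw [X_sub_C_mul_X_sub_C, coeff_one_quadratic_modByMonic]; abel
  have e2 : ((X - C h₁) * (X - C h₂) %ₘ quadrance h₂).coeff 1 = rev h₂ - h₁ := by
    rw [X_sub_C_mul_X_sub_C, coeff_one_quadratic_modByMonic]; abel
  refine and_congr_right fun _ => ?_
  constructor
  · rintro ⟨⟨l, hl'⟩, hl⟩
    have h2 : l < 2 := hl'
    interval_cases l
    · left
      simpa [linProd, coeff_one_X_sub_C_modByMonic, e1] using hl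
    · right
      simpa [linProd, coeff_one_X_sub_C_modByMonic, e2] using hl
  · rintro (h | h)
    · exact ⟨⟨0, by simp⟩, Or.inr (by simpa [linProd, e1] using h)⟩
    · exact ⟨⟨1, by simp⟩, Or.inl (by simpa [linProd, e2] using h)⟩

theorem eval_quadratic (A B : CGA) (t : ℝ) :
    (X ^ 2 + C A * X + C B : CGA[X]).eval (algebraMap ℝ CGA t) =
      algebraMap ℝ CGA (t ^ 2) + t • A + B := by
  rw [eval_add, eval_add, eval_C_mul, eval_X, eval_C, sq, eval_mul_X, eval_X, sq, map_mul,
    ← Algebra.commutes t A, ← Algebra.smul_def t A]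

theorem euclidean_transform_quadratic (a a' A B : CGA) (α β : ℝ) :
    C a * (X ^ 2 + C A * X + C B : CGA[X]).comp
      (C (algebraMap ℝ CGA α) * X + C (algebraMap ℝ CGA β)) * C a' =
    C (α ^ 2 • (a * a')) * X ^ 2 + C (a * (α • A + (2 * α * β) • 1) * a') * X +
      C (a * (β ^ 2 • 1 + β • A + B) * a') := by
  have hα : (C (algebraMap ℝ CGA α) : CGA[X]) = α • 1 := by
    rw [Algebra.algebraMap_eq_smul_one, ← smul_C, map_one]
  have hβ : (C (algebraMap ℝ CGA β) : CGA[X]) = β • 1 := by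
    rw [Algebra.algebraMap_eq_smul_one, ← smul_C, map_one]
  rw [add_comp, add_comp, C_mul_comp, X_pow_comp, X_comp, C_comp, hα, hβ]
  simp only [sq, mul_add, add_mul, ← smul_C, map_add, map_mul, smul_mul_assoc, mul_smul_comm,
    one_mul, mul_one, smul_smul, smul_add, mul_assoc, X_mul]
  module

/-! ### Circular translations -/

/-- The quaternion unit `k`. -/
def quatK : ℍ[ℝ] := mkQuat 0 0 0 1

theorem quatK_mul_self : quatK * quatK = -1 := by
  ext <;> simp [quatK]

theorem dq_one_zero : dq 1 0 = 1 := by simp [dq]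

theorem circTrans_eq (x y : ℝ) :
    circTrans x y = X ^ 2 + C (dq 0 (mkQuat 0 x (-y) 0)) * X + C (dq 1 (mkQuat 0 y x 0)) := by
  rw [circTrans, X_sub_C_mul_X_sub_C, quadratic_inj, e₁₂_eq_dq, circLeft_eq_dq, dq_mul, dq_add,
    dq_neg, dq_inj, dq_inj]
  refine ⟨⟨?_, ?_⟩, ?_, ?_⟩ <;> ext <;> simp

/-- Two non-exceptional parameters suffice: cross-multiplying the two values eliminates h, and t²
and f(t) contribute only reals. -/
theorem IsTrivialMotion.exists_real_combination {A B : CGA}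
    (h : IsTrivialMotion (X ^ 2 + C A * X + C B)) :
    ∃ t₁ t₂ c₁ c₂ r : ℝ, t₁ ≠ t₂ ∧ c₁ ≠ 0 ∧ c₂ ≠ 0 ∧
      c₁ • (t₁ • A + B) + c₂ • (t₂ • A + B) = algebraMap ℝ CGA r := by
  obtain ⟨f, h, -, -, hfin⟩ := h
  obtain ⟨t₁, h₁⟩ := hfin.exists_notMem
  obtain ⟨t₂, h₂⟩ := (hfin.insert t₁).exists_notMem
  simp only [Set.mem_insert_iff, not_or] at h₂
  obtain ⟨hne, h₂⟩ := h₂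
  simp only [Set.mem_ofPred_eq, not_not, eval_quadratic] at h₁ h₂
  obtain ⟨c₁, hc₁, h₁⟩ := h₁
  obtain ⟨c₂, hc₂, h₂⟩ := h₂
  refine ⟨t₁, t₂, c₂, -c₁, c₂ * (c₁ * f t₁ - t₁ ^ 2) - c₁ * (c₂ * f t₂ - t₂ ^ 2), Ne.symm hne, hc₂,
    neg_ne_zero.mpr hc₁, ?_⟩
  rw [add_assoc, ← eq_sub_iff_add_eq'] at h₁ h₂
  rw [h₁, h₂]
  simp only [Algebra.algebraMap_eq_smul_one]
  module

theorem circTrans_combination_ne_real {x y : ℝ} (hxy : (x, y) ≠ (0, 0)) {t₁ t₂ c₁ c₂ : ℝ}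
    (ht : t₁ ≠ t₂) (hc₁ : c₁ ≠ 0) (r : ℝ) :
    c₁ • (t₁ • dq 0 (mkQuat 0 x (-y) 0) + dq 1 (mkQuat 0 y x 0)) +
      c₂ • (t₂ • dq 0 (mkQuat 0 x (-y) 0) + dq 1 (mkQuat 0 y x 0)) ≠ algebraMap ℝ CGA r := by
  intro h
  rw [algebraMap_eq_dq] at h
  simp only [dq_smul, dq_add, dq_inj] at h
  have hi := congrArg (fun q : ℍ[ℝ] => q.imI) h.2
  have hj := congrArg (fun q : ℍ[ℝ] => q.imJ) h.2
  simp at hi hj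
  have hpos : x ^ 2 + y ^ 2 ≠ 0 := by
    intro h0
    have hx : x = 0 := by nlinarith [sq_nonneg x, sq_nonneg y]
    have hy : y = 0 := by nlinarith [sq_nonneg x, sq_nonneg y]
    exact hxy (by rw [hx, hy])
  -- The vectors (x, -y) and (y, x) are orthogonal of squared length x² + y²; pairing with each
  -- isolates its coefficient.
  have h1 : (c₁ + c₂) * (x ^ 2 + y ^ 2) = 0 := by linear_combination y * hi + x * hj
  have h2 : (c₁ * t₁ + c₂ * t₂) * (x ^ 2 + y ^ 2) = 0 := by linear_combination x * hi - y * hj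
  have h1 := (mul_eq_zero.mp h1).resolve_right hpos
  have h2 := (mul_eq_zero.mp h2).resolve_right hpos
  have h3 : c₁ * (t₁ - t₂) = 0 := by linear_combination h2 - t₂ * h1
  exact (mul_ne_zero hc₁ (sub_ne_zero.mpr ht)) h3

theorem circLeft_mem_even (x y : ℝ) : circLeft x y ∈ CGAeven := by
  rw [circLeft_eq_dq]; exact dq_mem_even _ _

theorem rev_circLeft (x y : ℝ) : rev (circLeft x y) = -circLeft x y := by
  rw [circLeft_eq_dq, rev_dq, dq_neg, dq_inj]
  constructor <;> ext <;> simp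

theorem circLeft_mul_self (x y : ℝ) : circLeft x y * circLeft x y = -1 := by
  rw [circLeft_eq_dq, dq_mul, ← dq_one_zero, dq_neg, dq_inj]
  constructor <;> ext <;> simp

theorem rev_e₁₂ : rev (e₁ * e₂) = -(e₁ * e₂) := by
  rw [e₁₂_eq_dq, rev_dq, dq_neg, dq_inj]
  constructor <;> ext <;> simp

theorem e₁₂_mul_self : e₁ * e₂ * (e₁ * e₂) = -1 := by
  rw [e₁₂_eq_dq, dq_mul, ← dq_one_zero, dq_neg, dq_inj]
  constructor <;> ext <;> simp

theorem circLeft_add_e₁₂ (x y : ℝ) : circLeft x y + e₁ * e₂ = dq 0 (mkQuat 0 (-x) y 0) := by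
  rw [circLeft_eq_dq, e₁₂_eq_dq, dq_add, dq_inj]
  constructor <;> ext <;> simp

theorem isMotionPolynomial_conj {a k : CGA} {r : ℝ} (hr : r ≠ 0) (hae : a ∈ CGAeven)
    (ha' : rev a ∈ CGAeven) (har : a * rev a = algebraMap ℝ CGA r)
    (har' : rev a * a = algebraMap ℝ CGA r) (hk : k ∈ CGAeven) (hkr : rev k = -k)
    (hkk : k * k = -1) (α β : ℝ) :
    IsMotionPolynomial (X - C (algebraMap ℝ CGA β + (α / r) • (rev a * k * a))) := by
  have hrr : rev (rev a) = a := CliffordAlgebra.reverse_reverse a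
  have hu : rev ((α / r) • (rev a * k * a)) = -((α / r) • (rev a * k * a)) := by
    rw [rev_smul, rev_mul, rev_mul, hrr, hkr, neg_mul, mul_neg, smul_neg, mul_assoc]
  have hcc : rev a * k * a * (rev a * k * a) = (-(r * r)) • 1 := by
    have : rev a * k * a * (rev a * k * a) = rev a * k * (a * rev a) * k * a := by
      simp only [mul_assoc]
    rw [this, har, ← Algebra.commutes, ← Algebra.smul_def, smul_mul_assoc, smul_mul_assoc,
      mul_assoc (rev a), hkk, mul_neg_one, neg_mul, har', Algebra.algebraMap_eq_smul_one]
    module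
  refine isMotionPolynomial_X_sub_C (s := 2 * β) (n := β ^ 2 + α ^ 2) ?_ ?_ ?_
  · exact add_mem (algebraMap_mem _ _) (Subalgebra.smul_mem _ (mul_mem (mul_mem ha' hk) hae) _)
  · rw [rev_add, rev_algebraMap, hu, two_mul, map_add]; abel
  · rw [rev_add, rev_algebraMap, hu, mul_add, add_mul, add_mul, mul_neg,
      mul_neg, smul_mul_smul_comm, hcc, smul_smul]
    have : α / r * (α / r) * -(r * r) = - α ^ 2 := by field_simp
    rw [this]
    simp only [Algebra.algebraMap_eq_smul_one, smul_mul_assoc, mul_smul_comm, one_mul, mul_one]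
    module

theorem isMotionPolynomial_of_sq {k : CGA} (hk : k ∈ CGAeven) (hkr : rev k = -k)
    (hkk : k * k = -1) : IsMotionPolynomial (X - C k) :=
  isMotionPolynomial_X_sub_C hk (s := 0) (n := 1) (by rw [hkr]; simp) (by rw [hkr]; simp [hkk])

theorem isMotionPolynomial_circLeft (x y : ℝ) : IsMotionPolynomial (X - C (circLeft x y)) :=
  isMotionPolynomial_of_sq (circLeft_mem_even x y) (rev_circLeft x y) (circLeft_mul_self x y)

theorem isMotionPolynomial_e₁₂ : IsMotionPolynomial (X - C (e₁ * e₂)) :=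
  isMotionPolynomial_of_sq (e_mul_e_mem_even _ _) rev_e₁₂ e₁₂_mul_self

theorem isEuclideanMotionPolynomial_circTrans (x y : ℝ) :
    IsEuclideanMotionPolynomial (circTrans x y) := by
  refine ⟨(isMotionPolynomial_circLeft x y).mul isMotionPolynomial_e₁₂, fun i => ?_⟩
  have h1 : (1 : CGA) ∈ DH := mem_DH_iff.mpr ⟨1, 0, dq_one_zero.symm⟩
  have h (p q) : dq p q ∈ DH := mem_DH_iff.mpr ⟨p, q, rfl⟩
  rw [circTrans_eq, coeff_add, coeff_add, coeff_X_pow, coeff_C_mul, coeff_X, coeff_C]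
  refine add_mem (add_mem ?_ ?_) ?_ <;> split_ifs <;> simp [h, h1]

theorem isIrregularFactorization_circTrans (x y : ℝ) :
    IsIrregularFactorization (circTrans x y) [circLeft x y, e₁ * e₂] := by
  rw [isIrregularFactorization_pair_iff, rev_circLeft, ← neg_add', circLeft_add_e₁₂, dq_neg]
  refine ⟨⟨?_, (linProd_pair _ _).symm⟩, Or.inl ?_⟩
  · simp only [List.mem_cons, List.not_mem_nil, or_false]
    rintro h (rfl | rfl)
    exacts [isMotionPolynomial_circLeft x y, isMotionPolynomial_e₁₂]
  · rw [neg_zero]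
    exact not_isUnit_dq_zero _

theorem not_isTrivialMotion_circTrans {x y : ℝ} (hxy : (x, y) ≠ (0, 0)) :
    ¬ IsTrivialMotion (circTrans x y) := by
  rw [circTrans_eq]
  intro h
  obtain ⟨t₁, t₂, c₁, c₂, r, ht, hc₁, -, h⟩ := h.exists_real_combination
  exact circTrans_combination_ne_real hxy ht hc₁ r h

theorem euclideanEquivalent_quadratic_iff {A B A' B' : CGA} :
    EuclideanEquivalent (X ^ 2 + C A * X + C B) (X ^ 2 + C A' * X + C B') ↔
      ∃ a : CGA, IsEuclideanDisplacement a ∧ ∃ c α β : ℝ, c ≠ 0 ∧ α ≠ 0 ∧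
        c • 1 = α ^ 2 • (a * rev a) ∧ c • A' = a * (α • A + (2 * α * β) • 1) * rev a ∧
        c • B' = a * (β ^ 2 • 1 + β • A + B) * rev a := by
  unfold EuclideanEquivalent
  simp only [euclidean_transform_quadratic]
  refine exists_congr fun a => and_congr_right fun _ => exists_congr fun c =>
    exists_congr fun α => exists_congr fun β => and_congr_right fun _ => and_congr_right fun _ => ?_
  constructor
  · intro h
    refine ⟨?_, ?_, ?_⟩
    · simpa [coeff_X, coeff_C, -Polynomial.smul_C] using congrArg (fun P => P.coeff 2) h
    · simpa [coeff_X, coeff_C, -map_mul, -map_add] using congrArg (fun P => P.coeff 1) h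
    · simpa [coeff_X, coeff_C, -map_mul, -map_add] using congrArg (fun P => P.coeff 0) h
  · rintro ⟨h2, h1, h0⟩
    rw [← h2, ← h1, ← h0, smul_add, smul_add, ← smul_C, ← smul_C, ← smul_C, map_one,
      smul_mul_assoc, smul_mul_assoc, one_mul]

theorem not_isTrivialMotion_of_equivalent {A B : CGA} {x y : ℝ} (hxy : (x, y) ≠ (0, 0))
    (h : EuclideanEquivalent (X ^ 2 + C A * X + C B) (circTrans x y)) :
    ¬ IsTrivialMotion (X ^ 2 + C A * X + C B) := by
  rw [circTrans_eq, euclideanEquivalent_quadratic_iff] at h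
  obtain ⟨a, ⟨-, r, -, har, -⟩, c, α, β, hc, hα, -, hA, hB⟩ := h
  intro h
  obtain ⟨t₁, t₂, c₁, c₂, ρ, ht, hc₁, -, h⟩ := h.exists_real_combination
  -- Undoing the parameter change turns t into (t - β)/α. The affine parts then correspond up to a
  -- real summand, which the conjugation keeps real.
  have key (t : ℝ) : c • (((t - β) / α) • dq 0 (mkQuat 0 x (-y) 0) + dq 1 (mkQuat 0 y x 0)) =
      a * (t • A + B + (2 * (t - β) * β + β ^ 2) • 1) * rev a := by
    rw [smul_add, smul_comm, hA, hB, ← smul_mul_assoc, ← mul_smul_comm, ← add_mul, ← mul_add]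
    congr 2
    match_scalars <;> field_simp <;> ring
  have comb (z₁ z₂ : CGA) : c₁ • (a * z₁ * rev a) + c₂ • (a * z₂ * rev a) =
      a * (c₁ • z₁ + c₂ • z₂) * rev a := by
    simp only [mul_add, add_mul, mul_smul_comm, smul_mul_assoc]
  refine circTrans_combination_ne_real hxy (t₁ := (t₁ - β) / α) (t₂ := (t₂ - β) / α) (c₁ := c * c₁)
    (c₂ := c * c₂) ?_ (mul_ne_zero hc hc₁)
    ((ρ + c₁ * (2 * (t₁ - β) * β + β ^ 2) + c₂ * (2 * (t₂ - β) * β + β ^ 2)) * r) ?_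
  · intro h
    field_simp at h
    exact ht (by linarith)
  · rw [mul_comm c, mul_comm c, mul_smul, mul_smul, key, key, comb]
    have e1 : c₁ • (t₁ • A + B + (2 * (t₁ - β) * β + β ^ 2) • 1) +
        c₂ • (t₂ • A + B + (2 * (t₂ - β) * β + β ^ 2) • (1 : CGA)) =
        (c₁ • (t₁ • A + B) + c₂ • (t₂ • A + B)) +
        (c₁ * (2 * (t₁ - β) * β + β ^ 2) + c₂ * (2 * (t₂ - β) * β + β ^ 2)) • (1 : CGA) := by
      module
    rw [e1, h, ← Algebra.algebraMap_eq_smul_one, ← map_add, ← Algebra.commutes, mul_assoc, har,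
      ← map_mul]
    congr 1
    ring

/-- Inverting the equivalence sends each factor t - k to t - (β + (α/r) ã k a), where aã = r. The
critical coefficient is conjugated along and keeps zero primal part. -/
theorem irregularlyFactorizable_of_equivalent {A B : CGA} {x y : ℝ}
    (h : EuclideanEquivalent (X ^ 2 + C A * X + C B) (circTrans x y)) :
    IrregularlyFactorizable (X ^ 2 + C A * X + C B) := by
  rw [circTrans, X_sub_C_mul_X_sub_C, euclideanEquivalent_quadratic_iff] at h
  obtain ⟨a, ⟨haD, r, hr, har, har'⟩, c, α, β, hc, hα, h1, hA, hB⟩ := h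
  obtain ⟨p, q, rfl⟩ := mem_DH_iff.mp haD
  set a := dq p q with ha
  have hae : a ∈ CGAeven := dq_mem_even _ _
  have hae' : rev a ∈ CGAeven := by rw [ha, rev_dq]; exact dq_mem_even _ _
  have hc' : c = α ^ 2 * r := by
    rw [har, Algebra.algebraMap_eq_smul_one, smul_smul] at h1
    exact smul_left_injective ℝ (one_ne_zero (α := CGA)) h1
  have sandwich (z : CGA) : rev a * (a * z * rev a) * a = (r * r) • z := by
    have : rev a * (a * z * rev a) * a = (rev a * a) * z * (rev a * a) := by simp only [mul_assoc]
    rw [this, har', ← Algebra.commutes, ← Algebra.smul_def, ← Algebra.smul_def, smul_smul]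
  have hA' := sandwich (α • A + (2 * α * β) • 1)
  have hB' := sandwich (β ^ 2 • 1 + β • A + B)
  rw [← hA, hc', mul_smul_comm, smul_mul_assoc] at hA'
  rw [← hB, hc', mul_smul_comm, smul_mul_assoc] at hB'
  set k₁ := circLeft x y with hk₁
  set k₂ := e₁ * e₂ with hk₂
  set u₁ := rev a * k₁ * a with hu₁
  set u₂ := rev a * k₂ * a with hu₂
  have hsum : rev a * (-(k₁ + k₂)) * a = -(u₁ + u₂) := by
    rw [mul_neg, neg_mul, mul_add, add_mul]
  have hprod : u₁ * u₂ = r • (rev a * (k₁ * k₂) * a) := by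
    have : u₁ * u₂ = rev a * k₁ * (a * rev a) * k₂ * a := by simp only [hu₁, hu₂, mul_assoc]
    rw [this, har, ← Algebra.commutes, ← Algebra.smul_def, smul_mul_assoc, smul_mul_assoc,
      mul_assoc (rev a)]
  rw [hsum] at hA'
  have hAe : A = -((algebraMap ℝ CGA β + (α / r) • u₁) + (algebraMap ℝ CGA β + (α / r) • u₂)) := by
    have h2 : A = (r * r * α)⁻¹ • ((r * r) • (α • A + (2 * α * β) • (1 : CGA))) - (2 * β) • 1 := by
      match_scalars <;> field_simp
      ring
    rw [h2, ← hA', Algebra.algebraMap_eq_smul_one]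
    match_scalars <;> field_simp
    ring
  have hBe : B = (algebraMap ℝ CGA β + (α / r) • u₁) * (algebraMap ℝ CGA β + (α / r) • u₂) := by
    have h2 : B = (r * r)⁻¹ • ((r * r) • (β ^ 2 • (1 : CGA) + β • A + B)) - β ^ 2 • 1 - β • A := by
      match_scalars <;> field_simp <;> ring
    rw [h2, ← hB', hAe, mul_add, add_mul, add_mul, smul_mul_smul_comm, hprod]
    simp only [Algebra.algebraMap_eq_smul_one, smul_mul_assoc, mul_smul_comm, one_mul, mul_one]
    match_scalars <;> field_simp
    ring
  refine ⟨[algebraMap ℝ CGA β + (α / r) • u₁, algebraMap ℝ CGA β + (α / r) • u₂], ?_⟩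
  have hk₁r : rev k₁ = -k₁ := rev_circLeft x y
  rw [isIrregularFactorization_pair_iff]
  refine ⟨⟨?_, ?_⟩, Or.inl ?_⟩
  · simp only [List.mem_cons, List.not_mem_nil, or_false]
    rintro h (rfl | rfl)
    · exact isMotionPolynomial_conj hr hae hae' har har' (circLeft_mem_even x y) hk₁r
        (circLeft_mul_self x y) α β
    · exact isMotionPolynomial_conj hr hae hae' har har' (e_mul_e_mem_even _ _) rev_e₁₂
        e₁₂_mul_self α β
  · rw [linProd_pair, X_sub_C_mul_X_sub_C, ← hAe, ← hBe]
  · have hrr : rev (rev a) = a := CliffordAlgebra.reverse_reverse a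
    have h3 : rev (algebraMap ℝ CGA β + (α / r) • u₁) - (algebraMap ℝ CGA β + (α / r) • u₂) =
        -((α / r) • (rev a * (k₁ + k₂) * a)) := by
      rw [rev_add, rev_algebraMap, rev_smul, hu₁, rev_mul, rev_mul, hrr, hk₁r, hu₂, neg_mul,
        mul_neg, mul_add, add_mul, mul_assoc (rev a) k₁]
      module
    rw [h3, hk₁, hk₂, circLeft_add_e₁₂, ha, rev_dq, dq_mul, dq_mul, dq_smul, dq_neg]
    simpa using not_isUnit_dq_zero _

/-! ### Irregular factorizations of quadratic Euclidean motion polynomials -/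

theorem coe_eq_smul_one (r : ℝ) : (r : ℍ[ℝ]) = r • 1 := by
  ext <;> simp

/-- Non-invertibility forces A₀ to be s₁ or s₂, while reversion of h₁ + h₂ gives 2 Re A₀ = s₁ + s₂.
-/
theorem exists_shift_of_irregular {h₁ h₂ : CGA} {A₀ A₁ : ℍ[ℝ]} {s₁ s₂ : ℝ}
    (hs₁ : h₁ + rev h₁ = algebraMap ℝ CGA s₁) (hs₂ : h₂ + rev h₂ = algebraMap ℝ CGA s₂)
    (hA : h₁ + h₂ = dq A₀ A₁) (hu : ¬ IsUnit (rev h₁ - h₂) ∨ ¬ IsUnit (rev h₂ - h₁)) :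
    s₁ = s₂ ∧ A₀ = (s₁ : ℍ[ℝ]) ∧ star A₁ = -A₁ := by
  have e1 : rev h₁ - h₂ = dq (s₁ - A₀) (-A₁) := by
    rw [← sub_eq_iff_eq_add'.mpr hs₁.symm, sub_sub, hA, algebraMap_eq_dq, dq_sub, zero_sub]
  have e2 : rev h₂ - h₁ = dq (s₂ - A₀) (-A₁) := by
    rw [← sub_eq_iff_eq_add'.mpr hs₂.symm, sub_sub, add_comm h₂, hA, algebraMap_eq_dq, dq_sub,
      zero_sub]
  have e3 : dq (A₀ + star A₀) (A₁ + star A₁) = dq ((s₁ + s₂ : ℝ) : ℍ[ℝ]) 0 := by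
    rw [← dq_add, ← rev_dq, ← hA, ← algebraMap_eq_dq, map_add, ← hs₁, ← hs₂, rev_add]
    abel
  rw [dq_inj] at e3
  have e4 : 2 * A₀.re = s₁ + s₂ := by
    have := congrArg (fun q : ℍ[ℝ] => q.re) e3.1
    simp at this
    linarith
  have hA₀ : A₀ = s₁ ∨ A₀ = s₂ := by
    refine hu.imp (fun h => ?_) fun h => ?_
    · by_contra hne
      exact h (e1 ▸ isUnit_dq _ (sub_ne_zero.mpr (Ne.symm hne)))
    · by_contra hne
      exact h (e2 ▸ isUnit_dq _ (sub_ne_zero.mpr (Ne.symm hne)))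
  have hss : s₁ = s₂ := by
    rcases hA₀ with h | h <;> rw [h] at e4 <;> simp at e4 <;> linarith
  refine ⟨hss, ?_, by rw [eq_neg_iff_add_eq_zero, add_comm]; exact e3.2⟩
  rw [← hss] at hA₀
  exact hA₀.elim id id

/-- Substituting for one kᵢ in k₁k₂ gives k₁εq = n₁ - D₀ - εD₁ and εqk₂ = n₂ - D₀ - εD₁. Multiplying
by ε on the outer side of εq forces D₀ = n₁ = n₂. Purity of D₁ follows from (k₁ + k₂)² = 0, because
k₂k₁ is the reverse of k₁k₂. -/
theorem dual_part_of_product {k₁ k₂ : CGA} {q D₀ D₁ : ℍ[ℝ]} {n₁ n₂ : ℝ} (hr₁ : rev k₁ = -k₁)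
    (hr₂ : rev k₂ = -k₂) (hn₁ : k₁ * k₁ = -algebraMap ℝ CGA n₁)
    (hn₂ : k₂ * k₂ = -algebraMap ℝ CGA n₂) (hq : k₁ + k₂ = -dq 0 q) (hD : k₁ * k₂ = dq D₀ D₁) :
    D₀ = n₁ ∧ star D₁ = -D₁ ∧ k₁ * dq 0 q = -dq 0 D₁ := by
  have hk₂ : k₂ = -dq 0 q - k₁ := by rw [← hq]; abel
  have hk₁ : k₁ = -dq 0 q - k₂ := by rw [← hq]; abel
  have f1 : k₁ * dq 0 q = dq (n₁ - D₀) (-D₁) := by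
    have : k₁ * k₂ = -(k₁ * dq 0 q) - k₁ * k₁ := by rw [hk₂]; noncomm_ring
    rw [hD, hn₁, sub_neg_eq_add, algebraMap_eq_dq] at this
    rw [← zero_sub, ← dq_sub, this]
    abel
  have f2 : dq 0 q * k₂ = dq (n₂ - D₀) (-D₁) := by
    have : k₁ * k₂ = -(dq 0 q * k₂) - k₂ * k₂ := by
      nth_rw 1 [hk₁]; noncomm_ring
    rw [hD, hn₂, sub_neg_eq_add, algebraMap_eq_dq] at this
    rw [← zero_sub, ← dq_sub, this]
    abel
  have g1 : (n₁ : ℍ[ℝ]) = D₀ := by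
    have h : k₁ * dq 0 q * dq 0 1 = 0 := by
      rw [mul_assoc, dq_mul]; simp [dq]
    rw [f1, dq_mul] at h
    simpa [sub_eq_zero] using (dq_eq_zero h).2
  have g2 : (n₂ : ℍ[ℝ]) = D₀ := by
    have h : dq 0 1 * (dq 0 q * k₂) = 0 := by
      rw [← mul_assoc, dq_mul]; simp [dq]
    rw [f2, dq_mul] at h
    simpa [sub_eq_zero] using (dq_eq_zero h).2
  refine ⟨g1.symm, ?_, by rw [f1, g1, sub_self, dq_neg, neg_zero]⟩
  have h : dq D₀ D₁ + rev (dq D₀ D₁) = dq n₁ 0 + dq n₂ 0 := by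
    have e : (k₁ + k₂) * (k₁ + k₂) = 0 := by rw [hq, neg_mul_neg, dq_mul]; simp [dq]
    rw [← hD, rev_mul, hr₁, hr₂, neg_mul_neg, ← algebraMap_eq_dq, ← algebraMap_eq_dq,
      ← neg_eq_iff_eq_neg.mpr hn₁, ← neg_eq_iff_eq_neg.mpr hn₂, ← sub_eq_zero, ← e]
    noncomm_ring
  rw [rev_dq, dq_add, dq_add, dq_inj] at h
  rw [eq_neg_iff_add_eq_zero, add_comm]
  simpa using h.2

/-- As a right H-module, εH is generated by εq. Hence k, though perhaps not a dual quaternion, acts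
on it as the quaternion g = -wq⁻¹; acting twice on ε gives g² = -n. -/
theorem exists_root_of_dual_relation {k : CGA} {q w : ℍ[ℝ]} {n : ℝ}
    (hn : k * k = -algebraMap ℝ CGA n) (hq : q ≠ 0) (hk : k * dq 0 q = -dq 0 w) :
    ∃ g : ℍ[ℝ], g * g = -(n : ℍ[ℝ]) ∧ w = -(g * q) := by
  have e (p : ℍ[ℝ]) : k * dq 0 p = dq 0 (-(w * q⁻¹) * p) := by
    have : dq 0 p = dq 0 q * dq (q⁻¹ * p) 0 := by
      rw [dq_mul, ← mul_assoc q, mul_inv_cancel₀ hq]; simp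
    rw [this, ← mul_assoc, hk, dq_neg, dq_mul]
    simp [mul_assoc]
  refine ⟨-(w * q⁻¹), ?_, by rw [neg_mul, neg_neg, mul_assoc, inv_mul_cancel₀ hq, mul_one]⟩
  have h : k * k * dq 0 1 = dq 0 (-(w * q⁻¹) * -(w * q⁻¹)) := by
    rw [mul_assoc, e, e, mul_one]
  rw [hn, algebraMap_eq_dq, dq_neg, dq_mul, dq_inj] at h
  simpa using h.2.symm

theorem real_or_pure_of_mul_self {g : ℍ[ℝ]} {n : ℝ} (h : g * g = -(n : ℍ[ℝ])) :
    (∃ γ : ℝ, g = γ) ∨ star g = -g := by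
  have h0 := congrArg (fun q : ℍ[ℝ] => q.imI) h
  have h1 := congrArg (fun q : ℍ[ℝ] => q.imJ) h
  have h2 := congrArg (fun q : ℍ[ℝ] => q.imK) h
  simp at h0 h1 h2
  by_cases hr : g.re = 0
  · right
    ext <;> simp [hr]
  · left
    refine ⟨g.re, ?_⟩
    have hi : g.re * g.imI = 0 := by linarith
    have hj : g.re * g.imJ = 0 := by linarith
    have hk : g.re * g.imK = 0 := by linarith
    ext <;> simp
    exacts [(mul_eq_zero.mp hi).resolve_left hr, (mul_eq_zero.mp hj).resolve_left hr,
      (mul_eq_zero.mp hk).resolve_left hr]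

/-- The polynomial is (t - s)² + n + (t - s - γ)εq; division by t - s - γ leaves a real function
plus the constant εq. -/
theorem isTrivialMotion_of_dual_line (q : ℍ[ℝ]) (s n γ : ℝ) :
    IsTrivialMotion (X ^ 2 + C (dq (((-2 * s : ℝ)) : ℍ[ℝ]) q) * X +
      C (dq ((s ^ 2 + n : ℝ) : ℍ[ℝ]) (-(s + γ) • q))) := by
  refine ⟨fun t => ((t - s) ^ 2 + n) / (t - s - γ), -dq 0 q, neg_mem (dq_mem_even _ _), ⟨0, ?_⟩, ?_⟩
  · rw [dq_neg, rev_dq, dq_mul, algebraMap_eq_dq, dq_inj]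
    simp
  · refine (Set.finite_singleton (s + γ)).subset fun t ht => ?_
    by_contra hne
    apply ht
    have hne' : t - s - γ ≠ 0 := by
      intro h
      exact hne (by simp; linarith)
    refine ⟨t - s - γ, hne', ?_⟩
    rw [eval_quadratic, algebraMap_eq_dq, algebraMap_eq_dq, sub_neg_eq_add, dq_smul, dq_add, dq_add,
      dq_add, dq_smul, dq_inj]
    simp only [coe_eq_smul_one]
    constructor
    · match_scalars
      field_simp
      ring
    · module

/-- For every u, the quaternion u + α⁻¹kug intertwines g with -αk. The choice u = 1 vanishes only
for g = αk, and then u = i gives 2i. -/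
theorem exists_rotation_to_quatK {g : ℍ[ℝ]} {α : ℝ} (hα : α ≠ 0)
    (hg : g * g = -((α ^ 2 : ℝ) : ℍ[ℝ])) : ∃ a : ℍ[ℝ], a ≠ 0 ∧ a * g = -(α • (quatK * a)) := by
  have key (u : ℍ[ℝ]) : (u + α⁻¹ • (quatK * u * g)) * g =
      -(α • (quatK * (u + α⁻¹ • (quatK * u * g)))) := by
    have h1 : quatK * u * g * g = -(α ^ 2) • (quatK * u) := by
      rw [mul_assoc _ g, hg, mul_neg, ← Quaternion.coe_commutes, Quaternion.coe_mul_eq_smul,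
        neg_smul]
    have h2 : quatK * (quatK * u * g) = -(u * g) := by
      rw [mul_assoc, ← mul_assoc, quatK_mul_self, neg_one_mul]
    rw [add_mul, mul_add, smul_mul_assoc, mul_smul_comm, h1, h2]
    match_scalars <;> field_simp
  by_cases h : (1 : ℍ[ℝ]) + α⁻¹ • (quatK * 1 * g) = 0
  · refine ⟨_, ?_, key (mkQuat 0 1 0 0)⟩
    have hgk : g = α • quatK := by
      have h3 := congrArg (fun z => α • (quatK * z)) h
      simp only [mul_one, mul_add, mul_smul_comm, ← mul_assoc, quatK_mul_self, smul_add, mul_zero,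
        smul_zero, smul_smul, mul_inv_cancel₀ hα, one_smul, neg_one_mul] at h3
      exact (sub_eq_zero.mp (by rw [sub_eq_add_neg]; exact h3)).symm
    rw [hgk, mul_smul_comm, smul_smul, inv_mul_cancel₀ hα, one_smul]
    intro h4
    have := congrArg (fun z : ℍ[ℝ] => z.imI) h4
    simp [quatK] at this
  · exact ⟨_, h, key 1⟩

theorem exists_equivalent_circTrans {q g : ℍ[ℝ]} {s α : ℝ} (hα : α ≠ 0) (hq : q ≠ 0)
    (hqs : star q = -q) (hg : g * g = -((α ^ 2 : ℝ) : ℍ[ℝ]))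
    (hgq : star (g * q) = -(g * q)) :
    ∃ x y : ℝ, (x, y) ≠ (0, 0) ∧ EuclideanEquivalent
      (X ^ 2 + C (dq (((-2 * s : ℝ)) : ℍ[ℝ]) q) * X +
        C (dq ((s ^ 2 + α ^ 2 : ℝ) : ℍ[ℝ]) (-(g * q) - s • q))) (circTrans x y) := by
  obtain ⟨a, ha, hag⟩ := exists_rotation_to_quatK hα hg
  set r := normSq a with hr
  have hr0 : r ≠ 0 := normSq_ne_zero.mpr ha
  have haa : a * star a = (r : ℍ[ℝ]) := Quaternion.self_mul_star a
  have haa' : star a * a = (r : ℍ[ℝ]) := Quaternion.star_mul_self a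
  set z := a * q * star a with hz
  have hz0 : z ≠ 0 := mul_ne_zero (mul_ne_zero ha hq) (star_ne_zero.mpr ha)
  have hkz : a * (g * q) * star a = -(α • (quatK * z)) := by
    rw [← mul_assoc, hag, hz]
    simp only [neg_mul, smul_mul_assoc, mul_assoc]
  have hzs : star z = -z := by
    simp only [hz, star_mul, star_star, hqs, mul_neg, neg_mul, mul_assoc]
  have hkzs : star (quatK * z) = -(quatK * z) := by
    have h1 := congrArg star hkz
    simp only [star_mul, star_star, star_neg, Quaternion.star_smul] at h1
    rw [← star_mul g, hgq, neg_mul, mul_neg, ← mul_assoc, hkz, neg_neg, ← star_mul] at h1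
    have h2 := congrArg (fun p => α⁻¹ • p) h1
    simp only [smul_neg, smul_smul, inv_mul_cancel₀ hα, one_smul] at h2
    exact (neg_eq_iff_eq_neg.mpr h2).symm
  have hre : z.re = 0 := by
    have := congrArg (fun p : ℍ[ℝ] => p.re) hzs
    simp at this
    linarith
  have him : z.imK = 0 := by
    have := congrArg (fun p : ℍ[ℝ] => p.re) hkzs
    simp [quatK] at this
    linarith
  -- These values solve αz = c(xi - yj) with c = α²r, the dual part of the linear coefficient; z has
  -- no real or k component.
  refine ⟨z.imI / (α * r), -(z.imJ / (α * r)), ?_, ?_⟩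
  · intro h
    simp only [Prod.mk.injEq, neg_eq_zero, div_eq_zero_iff, mul_eq_zero, hα, hr0, or_false] at h
    exact hz0 (by ext <;> simp [hre, him, h.1, h.2])
  · rw [circTrans_eq, euclideanEquivalent_quadratic_iff]
    refine ⟨dq a 0, ⟨mem_DH_iff.mpr ⟨_, _, rfl⟩, r, hr0, ?_, ?_⟩, α ^ 2 * r, α, s,
      mul_ne_zero (pow_ne_zero _ hα) hr0, hα, ?_, ?_, ?_⟩
    · rw [rev_dq, dq_mul, algebraMap_eq_dq, haa]; simp
    · rw [rev_dq, dq_mul, algebraMap_eq_dq, haa']; simp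
    · rw [rev_dq, dq_mul, haa, ← dq_one_zero, dq_smul, dq_smul, dq_inj]
      constructor
      · ext <;> simp
      · simp
    · have e1 : α • dq (((-2 * s : ℝ)) : ℍ[ℝ]) q + (2 * α * s) • (1 : CGA) = dq 0 (α • q) := by
        rw [← dq_one_zero, dq_smul, dq_smul, dq_add, dq_inj]
        simp only [coe_eq_smul_one]
        constructor <;> module
      have e2 : a * (α • q) * star a = α • z := by
        rw [mul_smul_comm, smul_mul_assoc]
      rw [e1, rev_dq, dq_mul, dq_mul, dq_smul, dq_inj]
      simp only [mul_zero, zero_mul, star_zero, add_zero, zero_add, smul_zero, e2, true_and]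
      ext <;> simp [hre, him] <;> field_simp
    · have e1 : s ^ 2 • (1 : CGA) + s • dq (((-2 * s : ℝ)) : ℍ[ℝ]) q +
          dq ((s ^ 2 + α ^ 2 : ℝ) : ℍ[ℝ]) (-(g * q) - s • q) = dq ((α ^ 2 : ℝ) : ℍ[ℝ]) (-(g * q)) := by
        rw [← dq_one_zero, dq_smul, dq_smul, dq_add, dq_add, dq_inj]
        simp only [coe_eq_smul_one]
        constructor <;> module
      rw [e1, rev_dq, dq_mul, dq_mul, dq_smul, dq_inj]
      simp only [mul_zero, zero_mul, star_zero, add_zero, zero_add, mul_neg, neg_mul, hkz, neg_neg]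
      rw [← Quaternion.coe_commutes, mul_assoc, haa]
      constructor
      · simp only [coe_eq_smul_one, mul_smul_comm, mul_one]
        module
      · ext <;> simp [hre, him, quatK] <;> field_simp

theorem IrregularlyFactorizable.exists_circTrans {P : CGA[X]}
    (hi : IrregularlyFactorizable P) (hP : IsEuclideanMotionPolynomial P) (hm : P.Monic)
    (hd : P.natDegree = 2) (ht : ¬ IsTrivialMotion P) :
    ∃ x y : ℝ, (x, y) ≠ (0, 0) ∧ EuclideanEquivalent P (circTrans x y) := by
  obtain ⟨hs, hf⟩ := hi
  have hlen : hs.length = 2 := by rw [← (monic_linProd hs).2, ← hf.1.2, hd]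
  obtain ⟨h₁, h₂, rfl⟩ := List.length_eq_two.mp hlen
  obtain ⟨⟨hfm, hfP⟩, hu⟩ := isIrregularFactorization_pair_iff.mp hf
  obtain ⟨-, s₁, N₁, hs₁, hN₁⟩ := exists_trace_norm_of_isMotionPolynomial (hfm h₁ (by simp))
  obtain ⟨-, s₂, N₂, hs₂, hN₂⟩ := exists_trace_norm_of_isMotionPolynomial (hfm h₂ (by simp))
  have hPq := eq_quadratic_of_monic hm hd
  have hPf := hfP
  rw [linProd_pair, X_sub_C_mul_X_sub_C] at hPf
  obtain ⟨A₀, A₁, hA⟩ := mem_DH_iff.mp (hP.2 1)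
  obtain ⟨B₀, B₁, hB⟩ := mem_DH_iff.mp (hP.2 0)
  rw [hA, hB] at hPq
  obtain ⟨hA', hB'⟩ := quadratic_inj.mp (hPq.symm.trans hPf)
  have hsum : h₁ + h₂ = dq (-A₀) (-A₁) := by rw [← dq_neg, hA', neg_neg]
  obtain ⟨hss, hA₀, hA₁⟩ := exists_shift_of_irregular hs₁ hs₂ hsum hu
  subst hss
  obtain ⟨s, rfl⟩ : ∃ s, s₁ = 2 * s := ⟨s₁ / 2, by ring⟩
  have hr (h : CGA) (hh : h + rev h = algebraMap ℝ CGA (2 * s)) :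
      rev (h - algebraMap ℝ CGA s) = -(h - algebraMap ℝ CGA s) := by
    rw [rev_sub, rev_algebraMap, eq_sub_of_add_eq' hh, two_mul, map_add]
    abel
  have hsq (h : CGA) (N : ℝ) (hh : h + rev h = algebraMap ℝ CGA (2 * s))
      (hN : h * rev h = algebraMap ℝ CGA N) :
      (h - algebraMap ℝ CGA s) * (h - algebraMap ℝ CGA s) = -algebraMap ℝ CGA (N - s ^ 2) := by
    rw [eq_sub_of_add_eq' hh, mul_sub] at hN
    have e : h * h = h * algebraMap ℝ CGA (2 * s) - algebraMap ℝ CGA N := by rw [← hN]; abel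
    rw [mul_sub, sub_mul, sub_mul, e]
    simp only [Algebra.algebraMap_eq_smul_one, smul_mul_assoc, mul_smul_comm, one_mul, mul_one]
    module
  have hA₀' : A₀ = ((-2 * s : ℝ) : ℍ[ℝ]) := by
    rw [← neg_neg A₀, hA₀]; ext <;> simp
  have hA₁' : star A₁ = -A₁ := by rwa [star_neg, neg_neg, neg_eq_iff_eq_neg] at hA₁
  obtain ⟨hD₀, hD₁, hk⟩ := dual_part_of_product (q := A₁) (D₀ := B₀ + s • A₀ + ((s ^ 2 : ℝ) : ℍ[ℝ]))
    (D₁ := B₁ + s • A₁) (hr h₁ hs₁) (hr h₂ hs₂) (hsq h₁ N₁ hs₁ hN₁) (hsq h₂ N₂ hs₂ hN₂)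
    (by
      have : h₁ - algebraMap ℝ CGA s + (h₂ - algebraMap ℝ CGA s) =
          (h₁ + h₂) - algebraMap ℝ CGA (2 * s) := by rw [two_mul, map_add]; abel
      rw [this, hsum, algebraMap_eq_dq, dq_sub, dq_neg, dq_inj, hA₀]
      simp)
    (by
      have : (h₁ - algebraMap ℝ CGA s) * (h₂ - algebraMap ℝ CGA s) =
          h₁ * h₂ + s • -(h₁ + h₂) + algebraMap ℝ CGA (s ^ 2) := by
        rw [mul_sub, sub_mul, sub_mul]
        simp only [Algebra.algebraMap_eq_smul_one, smul_mul_assoc, mul_smul_comm, one_mul, mul_one]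
        module
      rw [this, ← hA', ← hB', dq_smul, dq_add, algebraMap_eq_dq, dq_add, add_zero])
  set n := N₁ - s ^ 2 with hn
  have hB₀ : B₀ = ((s ^ 2 + n : ℝ) : ℍ[ℝ]) := by
    have := eq_sub_of_add_eq hD₀
    rw [eq_sub_of_add_eq this, hA₀']
    simp only [coe_eq_smul_one]
    module
  -- All degenerate cases end here: A₁ = 0 and g = 0 with γ = 0, and g real with γ = g.
  have triv (γ : ℝ) (h : B₁ + s • A₁ = -(γ • A₁)) : False := by
    apply ht
    rw [hPq, hA₀', hB₀, eq_sub_of_add_eq h]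
    convert isTrivialMotion_of_dual_line A₁ s n γ using 5
    module
  by_cases hq : A₁ = 0
  · refine (triv 0 ?_).elim
    rw [hq] at hk ⊢
    have : dq 0 (B₁ + s • (0 : ℍ[ℝ])) = 0 := by
      rw [← neg_eq_zero, ← hk]; simp [dq]
    simpa using (dq_eq_zero this).2
  · obtain ⟨g, hg, hw⟩ := exists_root_of_dual_relation (hsq h₁ N₁ hs₁ hN₁) hq hk
    rcases real_or_pure_of_mul_self hg with ⟨γ, rfl⟩ | hgs
    · refine (triv γ ?_).elim
      rw [hw, Quaternion.coe_mul_eq_smul]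
    · have hnorm : n = normSq g := by
        have h1 : g * star g = (n : ℍ[ℝ]) := by rw [hgs, mul_neg, hg, neg_neg]
        rw [Quaternion.self_mul_star] at h1
        exact (Quaternion.coe_injective h1).symm
      have hg0 : g ≠ 0 := by
        rintro rfl
        exact triv 0 (by rw [hw]; simp)
      have hpos : 0 < n := by
        rw [hnorm]
        exact lt_of_le_of_ne normSq_nonneg (Ne.symm (normSq_ne_zero.mpr hg0))
      have hsqrt : n = Real.sqrt n ^ 2 := (Real.sq_sqrt hpos.le).symm
      rw [hw, star_neg, neg_neg] at hD₁
      have key := exists_equivalent_circTrans (s := s) (Real.sqrt_pos.mpr hpos).ne' hq hA₁'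
        (by rw [← hsqrt]; exact hg) (neg_eq_iff_eq_neg.mp hD₁)
      rw [← hsqrt, ← hw, add_sub_cancel_right, ← hB₀, ← hA₀', ← hPq] at key
      exact key

end MotionPoly

end

theorem mainTheorem2 :
    (∀ P : Polynomial MotionPoly.CGA, MotionPoly.IsEuclideanMotionPolynomial P → P.Monic →
      P.natDegree = 2 →
      ((¬ MotionPoly.IsTrivialMotion P ∧ MotionPoly.IrregularlyFactorizable P) ↔
        ∃ x y : ℝ, (x, y) ≠ (0, 0) ∧
          MotionPoly.EuclideanEquivalent P (MotionPoly.circTrans x y))) ∧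
    (∀ x y : ℝ, (x, y) ≠ (0, 0) →
      MotionPoly.IsEuclideanMotionPolynomial (MotionPoly.circTrans x y) ∧
      (MotionPoly.circTrans x y).Monic ∧ (MotionPoly.circTrans x y).natDegree = 2 ∧
      ¬ MotionPoly.IsTrivialMotion (MotionPoly.circTrans x y) ∧
      MotionPoly.IsIrregularFactorization (MotionPoly.circTrans x y)
        [MotionPoly.circLeft x y, MotionPoly.e₁ * MotionPoly.e₂]) := by
  refine ⟨fun P hP hm hd => ⟨fun h => h.2.exists_circTrans hP hm hd h.1, ?_⟩,
    fun x y hxy => ⟨MotionPoly.isEuclideanMotionPolynomial_circTrans x y,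
      (Polynomial.monic_X_sub_C _).mul (Polynomial.monic_X_sub_C _), ?_,
      MotionPoly.not_isTrivialMotion_circTrans hxy,
      MotionPoly.isIrregularFactorization_circTrans x y⟩⟩
  · rintro ⟨x, y, hxy, h⟩
    rw [MotionPoly.eq_quadratic_of_monic hm hd] at h ⊢
    exact ⟨MotionPoly.not_isTrivialMotion_of_equivalent hxy h,
      MotionPoly.irregularlyFactorizable_of_equivalent h⟩
  · rw [MotionPoly.circTrans, (Polynomial.monic_X_sub_C _).natDegree_mul
      (Polynomial.monic_X_sub_C _), Polynomial.natDegree_X_sub_C, Polynomial.natDegree_X_sub_C]
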